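/- Call a compact connected metric space of topological dimension $1$ a curve. For a compact metric space $(X,d)$ let $C(X,X)$ be the space of continuous maps $X\to X$ with the topology of uniform convergence. For $f\in C(X,X)$ and $\varepsilon>0$, an $\varepsilon$-chain for $f$ from $x$ to $y$ is a finite sequence $x=x_0,x_1,\dots,x_n=y$ in $X$ with $n\ge 1$ such that $d(f(x_{i-1}),x_i)<\varepsilon$ for $i=1,\dots,n$. Let $CR(f)$ be the set of chain recurrent points of $f$, that is, of the points $x\in X$ such that for every $\varepsilon>0$ there is an $\varepsilon$-chain for $f$ from $x$ to $x$. Let 0-$CR$ be the class of all compact metric spaces $X$ such that $\{f\in C(X,X): \dim CR(f)=0\}$ is a dense $G_\delta$-subset of $C(X,X)$. Theorem. Every locally connected curve belongs to the class 0-$CR$. -/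

import Mathlib

/-- `c 0, …, c n` (with `n ≥ 1`) is an `ε`-chain for `f` from `x` to `y`: it starts at `x`, ends
at `y`, and `d (f (c i), c (i + 1)) < ε` for all `i < n`. Only the values `c 0, …, c n` matter.
A chain has at least one step (otherwise every point would be chain recurrent). -/
def IsEpsChain {X : Type*} [MetricSpace X] (f : X → X) (ε : ℝ) (x y : X) (n : ℕ) (c : ℕ → X) :
    Prop :=
  1 ≤ n ∧ c 0 = x ∧ c n = y ∧ ∀ i < n, dist (f (c i)) (c (i + 1)) < ε

/-- The set `CR(f)` of chain recurrent points of `f`: for each `ε > 0` there is an `ε`-chain for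
`f` from `x` to `x`. -/
def chainRecurrentSet {X : Type*} [MetricSpace X] (f : X → X) : Set X :=
  {x | ∀ ε > 0, ∃ (n : ℕ) (c : ℕ → X), IsEpsChain f ε x x n c}

/-- The class 0-CR: compact metric spaces `X` for which the maps `f : X → X` with zero-dimensional
set `CR(f)` form a dense `G_δ` subset of `C(X, X)`. For compact `X` the topology of `C(X, X)`
is that of uniform convergence. Dimension zero means nonempty with a basis of clopen sets. -/
def ZeroCR (X : Type*) [MetricSpace X] : Prop :=
  CompactSpace X ∧
    IsGδ {f : C(X, X) | smallInductiveDimension (chainRecurrentSet f) = 0} ∧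
    Dense {f : C(X, X) | smallInductiveDimension (chainRecurrentSet f) = 0}

/-- A curve is a one-dimensional continuum, i.e. a compact connected metric space of dimension one.
(For separable metric spaces the small inductive, large inductive and covering dimensions agree.) -/
def IsCurve (X : Type*) [MetricSpace X] : Prop :=
  CompactSpace X ∧ ConnectedSpace X ∧ smallInductiveDimension X = 1

open Set Filter Topology Metric

/-! For compact sets, dimension at most zero means being separated at every scale (`IsSeparatedAt`).
By upper semicontinuity of `CR`, separation of `CR(f)` at a scale persists near `f` at twice that
scale. Hence the maps with zero-dimensional `CR` form a countable intersection of open sets, and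
Baire reduces density to one scale at a time.

To perturb `f`, cover `X` by finitely many small open sets with zero-dimensional frontiers. Their
union `Z` is zero-dimensional and nowhere dense, and the pattern `σ` of membership in the cover is
locally constant off `Z`. Let `g` be a value `c (σ x) ∉ Z` close to `f x` away from `Z`. Near `Z`,
let it run along a short path to `f (ψ x)`, where `ψ` is locally constant and close to the identity;
this endpoint does not depend on `σ`, so `g` is continuous across `Z`. Short paths exist by local
connectedness. Chain recurrence of `g` is then confined to a thin neighbourhood of `Z` and the
finite set of values `c s`. -/

/-! ### Short paths from local connectedness -/

theorem IsPreconnected.exists_chain {X : Type*} [PseudoMetricSpace X] {C : Set X}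
    (hC : IsPreconnected C) {δ : ℝ} (hδ : 0 < δ) {x y : X} (hx : x ∈ C) (hy : y ∈ C) :
    ∃ (M : ℕ) (c : ℕ → X), c 0 = x ∧ (∀ n ≥ M, c n = y) ∧ (∀ n, dist (c n) (c (n + 1)) < δ) ∧
      ∀ n, c n ∈ C := by
  have key : Relation.ReflTransGen (fun a b => a ∈ C ∧ b ∈ C ∧ dist a b < δ) x y := by
    refine hC.induction₂'
      (fun a b => Relation.ReflTransGen (fun a b => a ∈ C ∧ b ∈ C ∧ dist a b < δ) a b)
      (fun a ha => ?_) (fun a b c _ _ _ hab hbc => hab.trans hbc) hx hy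
    filter_upwards [self_mem_nhdsWithin, mem_nhdsWithin_of_mem_nhds (ball_mem_nhds a hδ)]
      with b hb hab
    exact ⟨.single ⟨ha, hb, by rwa [dist_comm]⟩, .single ⟨hb, ha, hab⟩⟩
  induction key using Relation.ReflTransGen.head_induction_on with
  | refl => exact ⟨0, fun _ => y, rfl, fun _ _ => rfl, fun _ => by simpa using hδ, fun _ => hy⟩
  | @head z w h _ ih =>
    obtain ⟨M, c, h0, hM, hd, hm⟩ := ih h.2.1
    refine ⟨M + 1, fun n => Nat.casesOn n z c, rfl, ?_, ?_, ?_⟩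
    · rintro (_ | n) hn
      · omega
      · exact hM n (by omega)
    · rintro (_ | n)
      · simpa [h0] using h.2.2
      · exact hd n
    · rintro (_ | n)
      · exact h.1
      · exact hm n

theorem exists_isPreconnected_subset_ball (X : Type*) [PseudoMetricSpace X] [CompactSpace X]
    [LocallyConnectedSpace X] {ε : ℝ} (hε : 0 < ε) :
    ∃ δ > 0, ∀ x y : X, dist x y < δ →
      ∃ C : Set X, IsPreconnected C ∧ x ∈ C ∧ y ∈ C ∧ C ⊆ ball x ε := by
  obtain ⟨δ, hδ, h⟩ := lebesgue_number_lemma_of_metric (s := (univ : Set X))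
    (c := fun x : X => connectedComponentIn (ball x (ε / 2)) x) isCompact_univ
    (fun x => isOpen_ball.connectedComponentIn)
    (fun x _ => mem_iUnion.2 ⟨x, mem_connectedComponentIn (mem_ball_self (by positivity))⟩)
  refine ⟨δ, hδ, fun x y hxy => ?_⟩
  obtain ⟨z, hz⟩ := h x (mem_univ x)
  have hxz := hz (mem_ball_self hδ)
  refine ⟨_, isPreconnected_connectedComponentIn, hxz, hz (by rwa [mem_ball, dist_comm]), ?_⟩
  intro w hw
  have h1 := connectedComponentIn_subset _ _ hw
  have h2 := connectedComponentIn_subset _ _ hxz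
  rw [mem_ball] at *
  linarith [dist_triangle_right w x z]

/-- A `δ`-chain that is eventually constant from index `N` on can be refined to a finer one, all
steps being subdivided into the same number `M` of substeps. -/
theorem exists_refined_chain {X : Type*} [PseudoMetricSpace X] {δ δ' r : ℝ} (hδ' : 0 < δ')
    (h : ∀ x y : X, dist x y < δ → ∃ C : Set X, IsPreconnected C ∧ x ∈ C ∧ y ∈ C ∧ C ⊆ ball x r)
    {N : ℕ} {a : ℕ → X} (ha : ∀ k, dist (a k) (a (k + 1)) < δ) (hN : ∀ k ≥ N, a k = a N) :
    ∃ (M : ℕ) (b : ℕ → X), 0 < M ∧ b 0 = a 0 ∧ (∀ k, dist (b k) (b (k + 1)) < δ') ∧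
      (∀ k ≥ N * M, b k = a N) ∧ ∀ k, dist (b k) (a (k / M)) < r := by
  have h1 : ∀ k, ∃ (M : ℕ) (c : ℕ → X), c 0 = a k ∧ (∀ n ≥ M, c n = a (k + 1)) ∧
      (∀ n, dist (c n) (c (n + 1)) < δ') ∧ (∀ n, dist (c n) (a k) < r) ∧
      (k ≥ N → ∀ n, c n = a N) ∧ (k ≥ N → M = 0) := by
    intro k
    obtain ⟨C, hC, hx, hy, hr⟩ := h _ _ (ha k)
    by_cases hk : k ≥ N
    · refine ⟨0, fun _ => a N, (hN k hk).symm, fun _ _ => (hN _ (by omega)).symm,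
        fun _ => by simpa using hδ', fun _ => ?_, fun _ _ => rfl, fun _ => rfl⟩
      rw [← hN k hk]
      exact hr hx
    · obtain ⟨M, c, h0, hM, hd, hm⟩ := hC.exists_chain hδ' hx hy
      exact ⟨M, c, h0, hM, hd, fun n => hr (hm n), fun h => absurd h hk, fun h => absurd h hk⟩
  choose m c hc0 hcm hcd hcr hcN hmN using h1
  -- The sum bounds every `m k`; shorter subchains are padded by their constant tails. The `+ 1`
  -- keeps `M` positive.
  set M := (∑ k ∈ Finset.range N, m k) + 1 with hM
  have hmM : ∀ k, m k ≤ M := by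
    intro k
    by_cases hk : k < N
    · exact (Finset.single_le_sum (fun _ _ => Nat.zero_le _) (Finset.mem_range.2 hk)).trans
        (Nat.le_succ _)
    · simp [hmN k (by omega)]
  have hM0 : 0 < M := by omega
  refine ⟨M, fun k => c (k / M) (k % M), hM0, by simp [hc0], fun k => ?_, fun k hk => ?_,
    fun k => hcr _ _⟩
  · by_cases hk : k % M + 1 < M
    · have e1 : (k + 1) / M = k / M := by
        rw [Nat.add_div hM0]
        have : 1 / M = 0 := Nat.div_eq_of_lt (by omega)
        have h2 : 1 % M = 1 := Nat.mod_eq_of_lt (by omega)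
        rw [if_neg (by omega)]
        omega
      have e2 : (k + 1) % M = k % M + 1 := by
        have h2 : 1 % M = 1 := Nat.mod_eq_of_lt (by omega)
        rw [Nat.add_mod_of_add_mod_lt (by omega), h2]
      simp only [e1, e2]
      exact hcd _ _
    · have hlt := Nat.mod_lt k hM0
      have e0 : k + 1 = M * (k / M + 1) := by
        have := Nat.div_add_mod k M
        rw [mul_add]; omega
      have e1 : (k + 1) / M = k / M + 1 := by
        rw [e0]; exact Nat.mul_div_cancel_left _ hM0
      have e2 : (k + 1) % M = 0 := by
        rw [e0]; exact Nat.mul_mod_right _ _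
      have := hcd (k / M) (k % M)
      rw [show k % M + 1 = M by omega, hcm _ _ (hmM _)] at this
      simpa only [e1, e2, hc0] using this
  · exact hcN _ ((Nat.le_div_iff_mul_le hM0).2 hk) _

/-- Chains are refined repeatedly and read as step functions of `t`. They converge uniformly at a
geometric rate, and their jumps are below `δ n`, so the limit is continuous. -/
theorem exists_path_of_chain_refinement {X : Type*} [MetricSpace X] [CompleteSpace X] {C : ℝ}
    {δ : ℕ → ℝ} (hδ : ∀ n, 0 < δ n) (hδC : ∀ n, δ n ≤ C / 2 ^ n)
    (h : ∀ n (x y : X), dist x y < δ n →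
      ∃ S : Set X, IsPreconnected S ∧ x ∈ S ∧ y ∈ S ∧ S ⊆ ball x (C / 2 / 2 ^ n))
    {x y : X} (hxy : dist x y < δ 0) :
    ∃ γ : Path x y, ∀ t, dist (γ t) x < C + δ 0 := by
  let P : ℕ → ℕ × (ℕ → X) → Prop := fun n s => 0 < s.1 ∧ s.2 0 = x ∧
    (∀ k, dist (s.2 k) (s.2 (k + 1)) < δ n) ∧ ∀ k ≥ s.1, s.2 k = y
  have step : ∀ n (s : {s // P n s}), ∃ s' : {s // P (n + 1) s}, ∃ M : ℕ, 0 < M ∧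
      s'.1.1 = s.1.1 * M ∧ ∀ k, dist (s'.1.2 k) (s.1.2 (k / M)) < C / 2 / 2 ^ n := by
    rintro n ⟨⟨N, a⟩, hN, h0, hd, hy⟩
    obtain ⟨M, b, hM, hb0, hbd, hbN, hba⟩ := exists_refined_chain (hδ (n + 1)) (h n) hd
      (fun k hk => (hy k hk).trans (hy N le_rfl).symm)
    exact ⟨⟨(N * M, b), Nat.mul_pos hN hM, hb0.trans h0, hbd,
      fun k hk => (hbN k hk).trans (hy N le_rfl)⟩, M, hM, rfl, hba⟩
  choose F M hM0 hFM hF using step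
  let s0 : {s // P 0 s} := ⟨(1, fun k => if k = 0 then x else y), one_pos, by simp, by
    rintro (_ | k)
    · simpa using hxy
    · simpa using hδ 0, fun k hk => if_neg (by omega)⟩
  let s : ∀ n, {s // P n s} := fun n => Nat.rec s0 F n
  have hs : ∀ n, s (n + 1) = F n (s n) := fun n => rfl
  let g : unitInterval → ℕ → X := fun t n => (s n).1.2 ⌊(t : ℝ) * (s n).1.1⌋₊
  have hg : ∀ t n, dist (g t n) (g t (n + 1)) ≤ C / 2 / 2 ^ n := by
    intro t n
    have := hF n (s n) ⌊(t : ℝ) * (s (n + 1)).1.1⌋₊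
    -- Equal subdivision makes the indices match: `⌊t N M⌋ / M = ⌊t N⌋`.
    rw [← Nat.floor_div_natCast, hs, hFM, Nat.cast_mul, ← mul_assoc, mul_div_cancel_right₀] at this
    · rw [dist_comm]
      simp only [g, hs, hFM, Nat.cast_mul, ← mul_assoc]
      exact this.le
    · exact_mod_cast (hM0 n (s n)).ne'
  choose l hl using fun t => cauchySeq_tendsto_of_complete (cauchySeq_of_le_geometric_two (hg t))
  have hlg : ∀ t n, dist (g t n) (l t) ≤ C / 2 ^ n :=
    fun t => dist_le_of_le_geometric_two_of_tendsto (hg t) (hl t)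
  have hcont : Continuous l := by
    rw [Metric.continuous_iff]
    intro t ε hε
    have hlim : Tendsto (fun n : ℕ => C / 2 ^ n) atTop (𝓝 0) := by
      simpa [div_eq_mul_inv] using
        (tendsto_pow_atTop_nhds_zero_of_lt_one (r := (2 : ℝ)⁻¹) (by norm_num)
          (by norm_num)).const_mul C
    obtain ⟨n, hn⟩ := (hlim.eventually (gt_mem_nhds (show 0 < ε / 3 by positivity))).exists
    have hNpos : (0 : ℝ) < (s n).1.1 := by exact_mod_cast (s n).2.1
    refine ⟨1 / (s n).1.1, by positivity, fun u hu => ?_⟩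
    have hu' : |(u : ℝ) * (s n).1.1 - t * (s n).1.1| < 1 := by
      rw [← sub_mul, abs_mul, abs_of_pos hNpos]
      rwa [Subtype.dist_eq, Real.dist_eq, lt_div_iff₀ hNpos] at hu
    have hfl : dist (g u n) (g t n) < δ n := by
      have hadj := (s n).2.2.2.1
      simp only [g]
      set p := (u : ℝ) * (s n).1.1
      set q := (t : ℝ) * (s n).1.1
      have hp : 0 ≤ p := mul_nonneg u.2.1 hNpos.le
      have hq : 0 ≤ q := mul_nonneg t.2.1 hNpos.le
      have h1 := Nat.floor_le hp
      have h2 := Nat.floor_le hq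
      have h3 := Nat.lt_floor_add_one p
      have h4 := Nat.lt_floor_add_one q
      rw [abs_lt] at hu'
      have h5 : ⌊p⌋₊ < ⌊q⌋₊ + 2 := by
        have : (⌊p⌋₊ : ℝ) < ⌊q⌋₊ + 2 := by linarith
        exact_mod_cast this
      have h6 : ⌊q⌋₊ < ⌊p⌋₊ + 2 := by
        have : (⌊q⌋₊ : ℝ) < ⌊p⌋₊ + 2 := by linarith
        exact_mod_cast this
      rcases lt_trichotomy ⌊p⌋₊ ⌊q⌋₊ with h7 | h7 | h7
      · rw [show ⌊q⌋₊ = ⌊p⌋₊ + 1 by omega]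
        exact hadj _
      · rw [h7, dist_self]
        exact hδ n
      · rw [show ⌊p⌋₊ = ⌊q⌋₊ + 1 by omega, dist_comm]
        exact hadj _
    have h1 := hlg u n
    have h2 := hlg t n
    have h3 := hδC n
    rw [dist_comm] at h1
    linarith [dist_triangle4 (l u) (g u n) (g t n) (l t)]
  have h0 : l 0 = x := by
    refine tendsto_nhds_unique (hl 0) ?_
    have : g 0 = fun _ => x := funext fun n => by simpa [g] using (s n).2.2.1
    rw [this]
    exact tendsto_const_nhds
  have h1 : l 1 = y := by
    refine tendsto_nhds_unique (hl 1) ?_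
    have : g 1 = fun _ => y := funext fun n => by simpa [g] using (s n).2.2.2.2 _ le_rfl
    rw [this]
    exact tendsto_const_nhds
  refine ⟨⟨⟨l, hcont⟩, h0, h1⟩, fun t => ?_⟩
  change dist (l t) x < _
  have h2 := hlg t 0
  rw [pow_zero, div_one, dist_comm] at h2
  have h3 : dist (g t 0) x < δ 0 := by
    change dist (if ⌊(t : ℝ) * ((1 : ℕ) : ℝ)⌋₊ = 0 then x else y) x < δ 0
    split_ifs
    · simpa using hδ 0
    · rwa [dist_comm]
  linarith [dist_triangle (l t) (g t 0) x]

/-- A compact locally connected metric space is uniformly locally path connected. -/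
theorem exists_path_in_ball (X : Type*) [MetricSpace X] [CompactSpace X]
    [LocallyConnectedSpace X] {ε : ℝ} (hε : 0 < ε) :
    ∃ δ > 0, ∀ x y : X, dist x y < δ → ∃ γ : Path x y, ∀ t, dist (γ t) x < ε := by
  have h : ∀ n : ℕ, ∃ δ > 0, δ ≤ ε / 2 / 2 ^ n ∧ ∀ x y : X, dist x y < δ →
      ∃ S : Set X, IsPreconnected S ∧ x ∈ S ∧ y ∈ S ∧ S ⊆ ball x (ε / 2 / 2 / 2 ^ n) := by
    intro n
    obtain ⟨δ, hδ, H⟩ :=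
      exists_isPreconnected_subset_ball X (show 0 < ε / 2 / 2 / 2 ^ n by positivity)
    exact ⟨min δ (ε / 2 / 2 ^ n), by positivity, min_le_right _ _,
      fun x y hxy => H x y (hxy.trans_le (min_le_left _ _))⟩
  choose δ hδ hδC H using h
  refine ⟨δ 0, hδ 0, fun x y hxy => ?_⟩
  obtain ⟨γ, hγ⟩ := exists_path_of_chain_refinement hδ hδC H hxy
  have := hδC 0
  exact ⟨γ, fun t => (hγ t).trans_le (by norm_num at this; linarith)⟩

/-! ### Zero-dimensionality as separation at every scale -/

section Separation

variable {X : Type*} [MetricSpace X]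

/-- `K` is `δ`-close to the image of a uniformly locally constant map: some `ψ` moves the points of
`K` by less than `δ` and identifies any two points of `K` that are close enough. -/
def IsSeparatedAt (K : Set X) (δ : ℝ) : Prop :=
  ∃ ρ > 0, ∃ ψ : X → X, (∀ x ∈ K, dist (ψ x) x < δ) ∧
    ∀ x ∈ K, ∀ y ∈ K, dist x y < ρ → ψ x = ψ y

theorem IsSeparatedAt.mono {K L : Set X} {δ δ' : ℝ} (h : IsSeparatedAt L δ) (hKL : K ⊆ L)
    (hδ : δ ≤ δ') : IsSeparatedAt K δ' := by
  obtain ⟨ρ, hρ, ψ, h1, h2⟩ := h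
  exact ⟨ρ, hρ, ψ, fun x hx => (h1 x (hKL hx)).trans_le hδ,
    fun x hx y hy => h2 x (hKL hx) y (hKL hy)⟩

theorem IsSeparatedAt.thickening {K : Set X} {δ : ℝ} (h : IsSeparatedAt K δ) (hδ : 0 < δ) :
    ∃ r > 0, IsSeparatedAt (thickening r K) (2 * δ) := by
  obtain ⟨ρ, hρ, ψ, h1, h2⟩ := h
  refine ⟨min (ρ / 3) δ, by positivity, min (ρ / 3) δ, by positivity, ?_⟩
  set r := min (ρ / 3) δ
  have hr1 : r ≤ ρ / 3 := min_le_left _ _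
  have hr2 : r ≤ δ := min_le_right _ _
  have : ∀ x, ∃ z, x ∈ Metric.thickening r K → z ∈ K ∧ dist x z < r := by
    intro x
    by_cases hx : x ∈ Metric.thickening r K
    · obtain ⟨z, hz⟩ := mem_thickening_iff.1 hx
      exact ⟨z, fun _ => hz⟩
    · exact ⟨x, fun h => absurd h hx⟩
  choose p hp using this
  refine ⟨ψ ∘ p, fun x hx => ?_, fun x hx y hy hxy => ?_⟩
  · have := h1 _ (hp x hx).1
    have := (hp x hx).2
    rw [dist_comm] at this
    have := dist_triangle (ψ (p x)) (p x) x
    simp only [Function.comp]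
    linarith
  · refine h2 _ (hp x hx).1 _ (hp y hy).1 ?_
    have h3 := (hp x hx).2
    have h4 := (hp y hy).2
    rw [dist_comm] at h3
    linarith [dist_triangle4 (p x) x y (p y)]

/-- `G` is split much more finely than `F`. A fibre of `ψG` that comes close to `F` is absorbed into
the class of a nearby point of `F`; the others keep their value. -/
theorem isSeparatedAt_union {F G : Set X} (hF : ∀ δ > 0, IsSeparatedAt F δ)
    (hG : ∀ δ > 0, IsSeparatedAt G δ) : ∀ δ > 0, IsSeparatedAt (F ∪ G) δ := by
  classical
  intro δ hδ
  obtain ⟨ρF, hρF, ψF, hF1, hF2⟩ := hF (δ / 2) (by positivity)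
  -- An absorbing point lies within `3 * t` of each point of the fibre: `4 * t ≤ ρF` lets `ψF`
  -- identify neighbours, and `δ / 2 + 3 * t ≤ δ` bounds the displacement.
  set t := min (ρF / 4) (δ / 6) with ht
  have ht0 : 0 < t := by positivity
  have ht1 : t ≤ ρF / 4 := min_le_left _ _
  have ht2 : t ≤ δ / 6 := min_le_right _ _
  obtain ⟨ρG, hρG, ψG, hG1, hG2⟩ := hG t ht0
  let Q : X → X → Prop := fun v y => y ∈ F ∧ ∃ x' ∈ G, ψG x' = v ∧ dist x' y < t
  let θ : X → X := fun v => if h : ∃ y, Q v y then ψF h.choose else v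
  have hθ : ∀ x ∈ G, ∀ y, Q (ψG x) y → ∃ y', y' ∈ F ∧ dist y' x < 3 * t ∧
      θ (ψG x) = ψF y' := by
    intro x hx y hy
    have hex : ∃ y, Q (ψG x) y := ⟨y, hy⟩
    obtain ⟨h1, x', hx', h2, h3⟩ := hex.choose_spec
    refine ⟨hex.choose, h1, ?_, dif_pos hex⟩
    have h4 := hG1 x' hx'
    have h5 := hG1 x hx
    rw [h2, dist_comm] at h4
    rw [dist_comm] at h3
    linarith [dist_triangle4 hex.choose x' (ψG x) x]
  have hmix : ∀ x ∈ F, x ∉ G → ∀ y ∈ G, dist x y < t → ψF x = θ (ψG y) := by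
    intro x hx _ y hy hxy
    obtain ⟨y', h1, h2, h3⟩ := hθ y hy x ⟨hx, y, hy, rfl, by rwa [dist_comm]⟩
    rw [h3]
    refine hF2 x hx y' h1 ?_
    rw [dist_comm] at h2
    linarith [dist_triangle x y y']
  refine ⟨min t ρG, by positivity, fun x => if x ∈ G then θ (ψG x) else ψF x, ?_, ?_⟩
  · intro x hx
    dsimp only
    split_ifs with hxG
    · by_cases hex : ∃ y, Q (ψG x) y
      · obtain ⟨y, hy⟩ := hex
        obtain ⟨y', h1, h2, h3⟩ := hθ x hxG y hy
        rw [h3]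
        have := hF1 y' h1
        linarith [dist_triangle (ψF y') y' x]
      · rw [show θ (ψG x) = ψG x from dif_neg hex]
        have := hG1 x hxG
        linarith
    · have := hF1 x (hx.resolve_right hxG)
      linarith
  · intro x hx y hy hxy
    have hxy1 : dist x y < t := hxy.trans_le (min_le_left _ _)
    have hxy2 : dist x y < ρG := hxy.trans_le (min_le_right _ _)
    dsimp only
    split_ifs with hxG hyG hyG
    · rw [hG2 x hxG y hyG hxy2]
    · exact (hmix y (hy.resolve_right hyG) hyG x hxG (by rwa [dist_comm])).symm
    · exact hmix x (hx.resolve_right hxG) hxG y hyG hxy1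
    · exact hF2 x (hx.resolve_right hxG) y (hy.resolve_right hyG) (by linarith)

theorem isSeparatedAt_biUnion {ι : Type*} (t : Finset ι) {F : ι → Set X}
    (h : ∀ i ∈ t, ∀ δ > 0, IsSeparatedAt (F i) δ) : ∀ δ > 0, IsSeparatedAt (⋃ i ∈ t, F i) δ := by
  classical
  induction t using Finset.induction_on with
  | empty => exact fun δ _ => ⟨1, one_pos, id, by simp, by simp⟩
  | insert a s _ ih =>
    rw [Finset.set_biUnion_insert]
    exact isSeparatedAt_union (h a (Finset.mem_insert_self _ _))
      (ih fun i hi => h i (Finset.mem_insert_of_mem hi))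

theorem Set.Finite.isSeparatedAt {C : Set X} (hC : C.Finite) : ∀ δ > 0, IsSeparatedAt C δ := by
  have := isSeparatedAt_biUnion hC.toFinset (F := fun x => {x}) fun x _ δ hδ =>
    ⟨1, one_pos, id, by simpa using hδ, by rintro _ rfl _ rfl _; rfl⟩
  simpa using this

theorem isSeparatedAt_of_hasSmallInductiveDimensionLT {K : Set X} (hK : IsCompact K)
    (h : HasSmallInductiveDimensionLT K 1) : ∀ δ > 0, IsSeparatedAt K δ := by
  classical
  intro δ hδ
  have : CompactSpace K := isCompact_iff_compactSpace.1 hK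
  rw [hasSmallInductiveDimensionLT_one_iff] at h
  have hb : ∀ x : K, ∃ U : Set K, IsClopen U ∧ x ∈ U ∧ U ⊆ ball x (δ / 2) := fun x => by
    obtain ⟨U, hU, hxU, hUb⟩ := h.exists_subset_of_mem_open
      (mem_ball_self (show 0 < δ / 2 by positivity)) isOpen_ball
    exact ⟨U, hU, hxU, hUb⟩
  choose U hU hxU hUb using hb
  obtain ⟨t, ht⟩ := isCompact_univ.elim_finite_subcover U (fun x => (hU x).isOpen)
    (fun x _ => mem_iUnion.2 ⟨x, hxU x⟩)
  let l : K → Set t := fun x => {i | x ∈ U i}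
  have hl : IsLocallyConstant l := by
    rw [IsLocallyConstant.iff_eventually_eq]
    intro x
    have : ∀ i : t, ∀ᶠ y in 𝓝 x, (y ∈ U i ↔ x ∈ U i) := by
      intro i
      by_cases hx : x ∈ U i
      · filter_upwards [(hU i).isOpen.mem_nhds hx] with y hy using iff_of_true hy hx
      · filter_upwards [(hU i).compl.isOpen.mem_nhds hx] with y hy using iff_of_false hy hx
    filter_upwards [eventually_all.2 this] with y hy
    ext i
    exact hy i
  obtain ⟨ρ, hρ, H⟩ := lebesgue_number_lemma_of_metric (s := (univ : Set K))
    (c := fun v => l ⁻¹' {v}) isCompact_univ (fun v => hl.isOpen_fiber v)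
    (fun x _ => mem_iUnion.2 ⟨l x, rfl⟩)
  -- The chosen representative depends only on the label `l x`, so equal labels give equal values.
  refine ⟨ρ, hρ, fun x => if hx : ∃ y : K, ∃ hx : x ∈ K, l y = l ⟨x, hx⟩ then hx.choose else x,
    fun x hx => ?_, fun x hx y hy hxy => ?_⟩
  · have hex : ∃ y : K, ∃ hx : x ∈ K, l y = l ⟨x, hx⟩ := ⟨⟨x, hx⟩, hx, rfl⟩
    simp only [dif_pos hex]
    obtain ⟨_, hlx⟩ := hex.choose_spec
    obtain ⟨i, hi, hxi⟩ := mem_iUnion₂.1 (ht (mem_univ (⟨x, hx⟩ : K)))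
    have h1 : hex.choose ∈ U i := by
      have : (⟨i, hi⟩ : t) ∈ l hex.choose := by rw [hlx]; exact hxi
      exact this
    have h2 := hUb i h1
    have h3 := hUb i hxi
    rw [mem_ball, Subtype.dist_eq] at h2 h3
    linarith [dist_triangle_right (hex.choose : X) x i]
  · obtain ⟨v, hv⟩ := H ⟨x, hx⟩ (mem_univ _)
    have h1 : l ⟨x, hx⟩ = v := hv (mem_ball_self hρ)
    have h2 : l ⟨y, hy⟩ = v := hv (by rw [mem_ball, dist_comm]; exact hxy)
    have : ∀ z : K, (∃ hx : x ∈ K, l z = l ⟨x, hx⟩) ↔ ∃ hy : y ∈ K, l z = l ⟨y, hy⟩ :=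
      fun z => ⟨fun ⟨_, h⟩ => ⟨hy, h.trans (h1.trans h2.symm)⟩,
        fun ⟨_, h⟩ => ⟨hx, h.trans (h2.trans h1.symm)⟩⟩
    have hfun := funext fun z => propext (this z)
    have hex : ∃ z : K, ∃ hx : x ∈ K, l z = l ⟨x, hx⟩ := ⟨⟨x, hx⟩, hx, rfl⟩
    have hey : ∃ z : K, ∃ hy : y ∈ K, l z = l ⟨y, hy⟩ := ⟨⟨y, hy⟩, hy, rfl⟩
    simp only [dif_pos hex, dif_pos hey]
    simp only [hfun]

theorem hasSmallInductiveDimensionLT_of_isSeparatedAt {K : Set X}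
    (h : ∀ δ > 0, IsSeparatedAt K δ) : HasSmallInductiveDimensionLT K 1 := by
  rw [hasSmallInductiveDimensionLT_one_iff]
  refine TopologicalSpace.isTopologicalBasis_of_isOpen_of_nhds (fun U hU => hU.isOpen) fun x V hx hV => ?_
  obtain ⟨ε, hε, hεV⟩ := Metric.isOpen_iff.1 hV x hx
  obtain ⟨ρ, hρ, ψ, h1, h2⟩ := h (ε / 2) (by positivity)
  have hl : IsLocallyConstant fun y : K => ψ y := by
    rw [IsLocallyConstant.iff_eventually_eq]
    intro y
    filter_upwards [ball_mem_nhds y hρ] with z hz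
    exact h2 z z.2 y y.2 hz
  refine ⟨_, hl.isClopen_fiber (ψ x), rfl, fun y hy => hεV ?_⟩
  have hy' : ψ y = ψ x := hy
  have h3 := h1 y y.2
  have h4 := h1 x x.2
  rw [hy', dist_comm] at h3
  rw [mem_ball, Subtype.dist_eq]
  linarith [dist_triangle (y : X) (ψ x) x]

theorem smallInductiveDimension_eq_zero_iff_isSeparatedAt {K : Set X} (hK : IsCompact K)
    (hne : K.Nonempty) :
    smallInductiveDimension K = 0 ↔ ∀ δ > 0, IsSeparatedAt K δ := by
  have : Nonempty K := hne.to_subtype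
  constructor
  · intro h
    exact isSeparatedAt_of_hasSmallInductiveDimensionLT hK
      (smallInductiveDimension_le_iff (n := 0).1 (by simp [h]))
  · intro h
    exact_mod_cast smallInductiveDimension_eq 0 (hasSmallInductiveDimensionLT_of_isSeparatedAt h)
      (by simp)

end Separation

/-! ### Semicontinuity of the chain recurrent set and the Baire argument -/

section ChainRecurrent

variable {X : Type*} [MetricSpace X]

/-- A limit point of an orbit is chain recurrent. Needed because the empty set does not have
dimension `0`. -/
theorem chainRecurrentSet_nonempty [CompactSpace X] [Nonempty X] (f : C(X, X)) :
    (chainRecurrentSet f).Nonempty := by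
  obtain ⟨x⟩ := ‹Nonempty X›
  obtain ⟨y, -, φ, hφ, hy⟩ := isCompact_univ.tendsto_subseq (x := fun n => f^[n] x)
    fun n => mem_univ _
  refine ⟨y, fun ε hε => ?_⟩
  have hfy : Tendsto (fun n => f (f^[φ n] x)) atTop (𝓝 (f y)) := (f.continuous.tendsto y).comp hy
  obtain ⟨N, hN⟩ := (((Metric.tendsto_nhds.1 hy) ε hε).and
    ((Metric.tendsto_nhds.1 hfy) ε hε)).exists_forall_of_atTop
  set m := φ N
  have hmn : m + 2 ≤ φ (N + 2) := by
    have h1 : φ N < φ (N + 1) := hφ (by omega)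
    have h2 : φ (N + 1) < φ (N + 2) := hφ (by omega)
    omega
  obtain ⟨k, hk⟩ := Nat.exists_eq_add_of_le hmn
  refine ⟨k + 2, fun i => if i = 0 ∨ i = k + 2 then y else f^[m + i] x, by omega, by simp,
    by simp, fun i hi => ?_⟩
  rcases Nat.eq_zero_or_pos i with rfl | hi0
  · have := (hN N le_rfl).2
    rw [← Function.iterate_succ_apply' f] at this
    simpa [dist_comm] using this
  · simp only [hi0.ne', hi.ne, Nat.succ_ne_zero, or_self, if_false, false_or]
    rw [← Function.iterate_succ_apply' f]
    split_ifs with h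
    · have := (hN (N + 2) (by omega)).1
      simp only [Function.comp, hk] at this
      rwa [show (m + i).succ = m + 2 + k by omega]
    · simpa [add_assoc] using hε

theorem eventually_notMem_chainRecurrentSet [CompactSpace X] {f : C(X, X)} {x : X}
    (hx : x ∉ chainRecurrentSet f) :
    ∀ᶠ p : C(X, X) × X in 𝓝 f ×ˢ 𝓝 x, p.2 ∉ chainRecurrentSet p.1 := by
  simp only [chainRecurrentSet, mem_ofPred_eq, not_forall] at hx
  obtain ⟨ε, hε, hx⟩ := hx
  have h4 : 0 < ε / 4 := by positivity
  have hd : ∀ᶠ y in 𝓝 x, dist (f y) (f x) < ε / 4 :=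
    Metric.tendsto_nhds.1 (f.continuous.tendsto x) _ h4
  filter_upwards [prod_mem_prod (ball_mem_nhds f h4) (inter_mem (ball_mem_nhds x h4) hd)]
  rintro ⟨g, y⟩ ⟨hg, hy, hfy⟩ hcr
  obtain ⟨n, c, hn, h0, hcn, hc⟩ := hcr (ε / 4) h4
  have hfg : ∀ z, dist (f z) (g z) < ε / 4 := fun z =>
    (ContinuousMap.dist_apply_le_dist z).trans_lt (by rwa [dist_comm])
  have hcx : ∀ i, i = 0 ∨ i = n → c i = y := by rintro i (rfl | rfl) <;> assumption
  refine hx ⟨n, fun i => if i = 0 ∨ i = n then x else c i, hn, by simp, by simp, fun i hi => ?_⟩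
  have e1 : dist (f (if i = 0 ∨ i = n then x else c i)) (f (c i)) < ε / 4 := by
    split_ifs with h
    · rw [hcx i h, dist_comm]; exact hfy
    · simpa using h4
  have e2 : dist (c (i + 1)) (if i + 1 = 0 ∨ i + 1 = n then x else c (i + 1)) < ε / 4 := by
    by_cases h : i + 1 = 0 ∨ i + 1 = n
    · rw [if_pos h, hcx _ h]; exact hy
    · rw [if_neg h, dist_self]; exact h4
  have e3 := hfg (c i)
  have e4 := hc i hi
  have t1 := dist_triangle4 (f (if i = 0 ∨ i = n then x else c i)) (f (c i)) (g (c i)) (c (i + 1))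
  have t2 := dist_triangle (f (if i = 0 ∨ i = n then x else c i)) (c (i + 1))
    (if i + 1 = 0 ∨ i + 1 = n then x else c (i + 1))
  dsimp only
  linarith

theorem isClosed_chainRecurrentSet [CompactSpace X] (f : C(X, X)) :
    IsClosed (chainRecurrentSet f) := by
  rw [← isOpen_compl_iff, isOpen_iff_mem_nhds]
  intro x hx
  have : Tendsto (fun y => (f, y)) (𝓝 x) (𝓝 f ×ˢ 𝓝 x) := tendsto_const_nhds.prodMk tendsto_id
  exact this.eventually (eventually_notMem_chainRecurrentSet hx)

/-- The chain recurrent set is an upper semicontinuous function of the map. -/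
theorem eventually_chainRecurrentSet_subset [CompactSpace X] {f : C(X, X)} {U : Set X}
    (hU : IsOpen U) (h : chainRecurrentSet f ⊆ U) :
    ∀ᶠ g : C(X, X) in 𝓝 f, chainRecurrentSet g ⊆ U := by
  have := hU.isClosed_compl.isCompact.eventually_forall_of_forall_eventually (x₀ := f)
    (P := fun g x => x ∉ chainRecurrentSet (g : C(X, X))) fun x hx => by
      rw [nhds_prod_eq]
      exact eventually_notMem_chainRecurrentSet fun hx' => hx (h hx')
  filter_upwards [this] with g hg x hx
  by_contra hxU
  exact hg x hxU hx

theorem mem_interior_isSeparatedAt [CompactSpace X] {f : C(X, X)} {δ : ℝ} (hδ : 0 < δ)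
    (h : IsSeparatedAt (chainRecurrentSet f) δ) :
    f ∈ interior {g : C(X, X) | IsSeparatedAt (chainRecurrentSet g) (2 * δ)} := by
  obtain ⟨r, hr, H⟩ := h.thickening hδ
  rw [mem_interior_iff_mem_nhds]
  filter_upwards [eventually_chainRecurrentSet_subset isOpen_thickening
    (self_subset_thickening hr _)] with g hg
  exact H.mono hg le_rfl

theorem zeroCR_of_dense [CompactSpace X] [Nonempty X]
    (h : ∀ δ > 0, Dense {f : C(X, X) | IsSeparatedAt (chainRecurrentSet f) δ}) : ZeroCR X := by
  let O : ℕ → Set C(X, X) := fun n =>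
    interior {g | IsSeparatedAt (chainRecurrentSet g) (2 * (1 / (n + 1)))}
  have hO : {f : C(X, X) | smallInductiveDimension (chainRecurrentSet f) = 0} = ⋂ n, O n := by
    ext f
    rw [mem_ofPred_eq, smallInductiveDimension_eq_zero_iff_isSeparatedAt
      (isClosed_chainRecurrentSet f).isCompact (chainRecurrentSet_nonempty f), mem_iInter]
    refine ⟨fun hf n => mem_interior_isSeparatedAt (by positivity) (hf _ (by positivity)),
      fun hf δ hδ => ?_⟩
    obtain ⟨n, hn⟩ := exists_nat_one_div_lt (show 0 < δ / 2 by positivity)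
    exact (interior_subset (hf n)).mono subset_rfl (by linarith)
  refine ⟨inferInstance, ?_, ?_⟩
  · rw [hO]
    exact .iInter_of_isOpen fun n => isOpen_interior
  · rw [hO]
    refine dense_iInter_of_isOpen_nat (fun n => isOpen_interior) fun n => ?_
    exact (h (1 / (n + 1)) (by positivity)).mono
      fun f hf => mem_interior_isSeparatedAt (by positivity) hf

end ChainRecurrent

/-! ### The perturbation and the density theorem -/

/-- If off a closed set the map `g` takes values in a finite set disjoint from it, then the chain
recurrent points off that closed set are among these values. -/
theorem chainRecurrentSet_subset_union {X : Type*} [MetricSpace X] {g : X → X} {C W : Set X}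
    (hC : C.Finite) (hW : IsClosed W) (hCW : Disjoint C W) (hgC : ∀ x ∉ W, g x ∈ C) :
    chainRecurrentSet g ⊆ W ∪ C := by
  intro x hx
  by_contra hxWC
  rw [mem_union, not_or] at hxWC
  obtain ⟨η, hη, hηC⟩ := hC.isCompact.exists_thickening_subset_open hW.isOpen_compl
    hCW.subset_compl_right
  have hCne : C.Nonempty := ⟨_, hgC x hxWC.1⟩
  have hpos : 0 < infDist x C := (hC.isClosed.notMem_iff_infDist_pos hCne).1 hxWC.2
  obtain ⟨n, c, hn, h0, hcn, hc⟩ := hx (min η (infDist x C)) (by positivity)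
  -- Each next point is `η`-close to `C`, hence off `W`, so its image lies in `C` again. The last
  -- step would then bring `x` too close to `C`.
  have key : ∀ i < n, g (c i) ∈ C := by
    intro i
    induction i with
    | zero => intro _; rw [h0]; exact hgC x hxWC.1
    | succ i ih =>
      intro hi
      refine hgC _ (hηC (mem_thickening_iff.2 ⟨_, ih (by omega), ?_⟩))
      rw [dist_comm]
      exact (hc i (by omega)).trans_le (min_le_left _ _)
  have h1 := hc (n - 1) (by omega)
  rw [Nat.sub_add_cancel hn, hcn, dist_comm] at h1
  exact absurd (infDist_le_dist_of_mem (x := x) (key (n - 1) (by omega)))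
    (not_le.2 (h1.trans_le (min_le_right _ _)))

theorem dense_isSeparatedAt_chainRecurrentSet {X : Type*} [MetricSpace X] [CompactSpace X]
    [Nonempty X] [LocallyConnectedSpace X] (hdim : HasSmallInductiveDimensionLE X 1) {δ : ℝ}
    (hδ : 0 < δ) : Dense {f : C(X, X) | IsSeparatedAt (chainRecurrentSet f) δ} := by
  classical
  rw [Metric.dense_iff]
  intro f ε hε
  obtain ⟨δp, hδp, hpath⟩ := exists_path_in_ball X (show 0 < ε / 4 by positivity)
  set d := min δp (ε / 4) with hd
  have hd0 : 0 < d := by positivity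
  have hd1 : d ≤ δp := min_le_left _ _
  have hd2 : d ≤ ε / 4 := min_le_right _ _
  obtain ⟨τ, hτ, hfτ⟩ := Metric.uniformContinuous_iff.1
    (CompactSpace.uniformContinuous_of_continuous f.continuous) (d / 3) (by positivity)
  -- A finite cover by small open sets whose frontiers are zero-dimensional.
  obtain ⟨S, hS, hfr⟩ : ∃ S : Set (Set X), TopologicalSpace.IsTopologicalBasis S ∧
      ∀ U ∈ S, HasSmallInductiveDimensionLT (frontier U) 1 := by
    cases hdim with
    | succ _ S hS h => exact ⟨S, hS, h⟩
  have hB : ∀ x : X, ∃ U ∈ S, x ∈ U ∧ U ⊆ ball x (τ / 2) := fun x =>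
    hS.exists_subset_of_mem_open (mem_ball_self (by positivity)) isOpen_ball
  choose B hBS hxB hBb using hB
  have hBo : ∀ x, IsOpen (B x) := fun x => hS.isOpen (hBS x)
  obtain ⟨t, ht⟩ := isCompact_univ.elim_finite_subcover B hBo
    (fun x _ => mem_iUnion.2 ⟨x, hxB x⟩)
  set Z := ⋃ i ∈ t, frontier (B i) with hZ
  have hZc : IsClosed Z := isClosed_biUnion_finset fun i _ => isClosed_frontier
  have hZs : ∀ η > 0, IsSeparatedAt Z η := isSeparatedAt_biUnion t fun i _ =>
    isSeparatedAt_of_hasSmallInductiveDimensionLT isClosed_frontier.isCompact (hfr _ (hBS i))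
  have hZd : Dense Zᶜ := by
    rw [hZ, compl_iUnion₂]
    refine dense_biInter_of_isOpen (S := (t : Set X)) (fun i _ => isClosed_frontier.isOpen_compl)
      t.countable_toSet fun i _ => ?_
    rw [← interior_eq_empty_iff_dense_compl]
    rw [← frontier_compl]
    exact interior_frontier (hBo i).isClosed_compl
  let σ : X → Set t := fun x => {i | x ∈ B i}
  have hσ : ∀ x ∉ Z, ∀ᶠ y in 𝓝 x, σ y = σ x := by
    intro x hx
    have : ∀ i : t, ∀ᶠ y in 𝓝 x, (y ∈ B i ↔ x ∈ B i) := by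
      intro i
      by_cases hxi : x ∈ B i
      · filter_upwards [(hBo i).mem_nhds hxi] with y hy using iff_of_true hy hxi
      · have hxc : x ∉ closure (B i) := fun hc => hx <| mem_biUnion i.2 <| by
          rw [(hBo i).frontier_eq]; exact ⟨hc, hxi⟩
        filter_upwards [isClosed_closure.isOpen_compl.mem_nhds hxc] with y hy
        exact iff_of_false (fun h => hy (subset_closure h)) hxi
    filter_upwards [eventually_all.2 this] with y hy
    ext i
    exact hy i
  have hσd : ∀ x y, σ x = σ y → dist x y < τ := by
    intro x y hxy
    obtain ⟨i, hi, hxi⟩ := mem_iUnion₂.1 (ht (mem_univ x))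
    have hyi : (⟨i, hi⟩ : t) ∈ σ y := by rw [← hxy]; exact hxi
    have h1 := hBb i hxi
    have h2 := hBb i hyi
    rw [mem_ball] at h1 h2
    linarith [dist_triangle_right x y i]
  have hc : ∀ s : Set t, ∃ c, c ∉ Z ∧ ∀ x, σ x = s → dist c (f x) < 2 * d / 3 := by
    intro s
    by_cases hs : ∃ x, σ x = s
    · obtain ⟨x, hx⟩ := hs
      obtain ⟨c, hc, hcx⟩ := hZd.exists_dist_lt (f x) (show 0 < d / 3 by positivity)
      refine ⟨c, hc, fun y hy => ?_⟩
      have h1 := hfτ (hσd x y (hx.trans hy.symm))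
      rw [dist_comm] at hcx
      linarith [dist_triangle c (f x) (f y)]
    · obtain ⟨c, hc⟩ := hZd.nonempty
      exact ⟨c, hc, fun x hx => absurd ⟨x, hx⟩ hs⟩
  choose c hcZ hcf using hc
  have hC : (range c).Finite := toFinite _
  obtain ⟨r₀, hr₀, hK⟩ := (isSeparatedAt_union hZs hC.isSeparatedAt (δ / 2)
    (by positivity)).thickening (by positivity)
  -- Thickening doubles the scale, so `ψ` moves points by less than `τ`.
  obtain ⟨r₁, hr₁, ρ, hρ, ψ, hψ1, hψ2⟩ := (hZs (τ / 2) (by positivity)).thickening (by positivity)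
  obtain ⟨r, hr, hrZ⟩ := hZc.isCompact.exists_cthickening_subset_open
    (t := thickening r₀ (Z ∪ range c) ∩ thickening r₁ Z ∩ (range c)ᶜ)
    ((isOpen_thickening.inter isOpen_thickening).inter hC.isClosed.isOpen_compl)
    (fun z hz => ⟨⟨self_subset_thickening hr₀ _ (Or.inl hz), self_subset_thickening hr₁ _ hz⟩, by
      rintro ⟨s, rfl⟩; exact hcZ s hz⟩)
  obtain ⟨u, hu0, hu1, hu⟩ := exists_continuous_zero_one_of_isClosed
    (isOpen_thickening (δ := r) (E := Z)).isClosed_compl hZc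
    (disjoint_compl_left_iff_subset.2 (self_subset_thickening hr Z))
  let v : X → unitInterval := fun x => ⟨u x, hu x⟩
  have hv : Continuous v := u.continuous.subtype_mk _
  have hv0 : ∀ x ∉ cthickening r Z, v x = 0 := fun x hx =>
    Subtype.ext (hu0 fun h => hx (thickening_subset_cthickening _ _ h))
  have hv1 : ∀ x ∈ Z, v x = 1 := fun x hx => Subtype.ext (hu1 hx)
  have hγ : ∀ s p, ∃ γ : C(unitInterval, X), γ 0 = c s ∧
      (dist (c s) (f p) < d → γ 1 = f p) ∧ ∀ a, dist (γ a) (c s) < ε / 4 := by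
    intro s p
    by_cases h : dist (c s) (f p) < d
    · obtain ⟨γ, hγ⟩ := hpath _ _ (h.trans_le hd1)
      exact ⟨γ.toContinuousMap, γ.source, fun _ => γ.target, hγ⟩
    -- A constant path for the pairs too far apart to be joined.
    · exact ⟨.const _ (c s), rfl, fun h' => absurd h' h, fun a => by simpa using hε⟩
  choose γ hγ0 hγ1 hγd using hγ
  have hψc : ∀ x ∈ thickening r₁ Z, ∀ᶠ y in 𝓝 x, y ∈ thickening r₁ Z ∧ ψ y = ψ x := by
    intro x hx
    filter_upwards [isOpen_thickening.mem_nhds hx, ball_mem_nhds x hρ] with y hy hyx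
    exact ⟨hy, hψ2 y hy x hx hyx⟩
  have hσψ : ∀ x ∈ thickening r₁ Z, dist (c (σ x)) (f (ψ x)) < d := by
    intro x hx
    have h1 := hcf _ x rfl
    have h2 := hψ1 x hx
    have h3 := hfτ (show dist x (ψ x) < τ by rw [dist_comm]; linarith)
    linarith [dist_triangle (c (σ x)) (f x) (f (ψ x))]
  let g : X → X := fun x => γ (σ x) (ψ x) (v x)
  have hgW : ∀ x ∉ cthickening r Z, g x = c (σ x) := fun x hx => by
    simp only [g, hv0 x hx, hγ0]
  have hg : Continuous g := by
    rw [continuous_iff_continuousAt]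
    intro x
    by_cases hxZ : x ∈ Z
    · have hx1 : x ∈ thickening r₁ Z := self_subset_thickening hr₁ _ hxZ
      have hgx : g x = f (ψ x) := by
        simp only [g, hv1 x hxZ]
        exact hγ1 _ _ (hσψ x hx1)
      rw [ContinuousAt, hgx, Metric.tendsto_nhds]
      intro e he
      -- `σ` may jump at `x`, but it has finitely many values, and every path in use ends at `f (ψ
      -- x)`.
      have : ∀ s : Set t, ∀ᶠ y in 𝓝 x, dist (c s) (f (ψ x)) < d →
          dist (γ s (ψ x) (v y)) (f (ψ x)) < e := by
        intro s
        by_cases hs : dist (c s) (f (ψ x)) < d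
        · have h1 : Tendsto (fun y => γ s (ψ x) (v y)) (𝓝 x) (𝓝 (γ s (ψ x) (v x))) :=
            ((γ s (ψ x)).continuous.comp hv).tendsto x
          rw [hv1 x hxZ, hγ1 _ _ hs] at h1
          filter_upwards [Metric.tendsto_nhds.1 h1 e he] with y hy _ using hy
        · exact .of_forall fun y h => absurd h hs
      filter_upwards [eventually_all.2 this, hψc x hx1] with y hy hy1
      have h2 := hσψ y hy1.1
      simp only [g]
      rw [hy1.2] at h2 ⊢
      exact hy _ h2
    · by_cases hx1 : x ∈ thickening r₁ Z
      · have : ContinuousAt (fun y => γ (σ x) (ψ x) (v y)) x :=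
          ((γ (σ x) (ψ x)).continuous.comp hv).continuousAt
        refine this.congr ?_
        filter_upwards [hσ x hxZ, hψc x hx1] with y hy hy1
        simp only [g, hy, hy1.2]
      · have hxW : x ∉ cthickening r Z := fun h => hx1 (hrZ h).1.2
        refine (continuousAt_const (y := c (σ x))).congr ?_
        filter_upwards [hσ x hxZ, isClosed_cthickening.isOpen_compl.mem_nhds hxW] with y hy hyW
        rw [hgW y hyW, hy]
  refine ⟨⟨g, hg⟩, ?_, ?_⟩
  · rw [mem_ball, ContinuousMap.dist_lt_iff hε]
    intro x
    have h1 : dist (g x) (c (σ x)) < ε / 4 := hγd _ _ _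
    have h2 := hcf _ x rfl
    change dist (g x) (f x) < ε
    linarith [dist_triangle (g x) (c (σ x)) (f x)]
  · refine hK.mono (δ' := δ) ((chainRecurrentSet_subset_union hC isClosed_cthickening
      (W := cthickening r Z) ?_ fun x hx => ?_).trans ?_) (by linarith)
    · exact disjoint_left.2 fun x hx hxW => (hrZ hxW).2 hx
    · exact ⟨_, (hgW x hx).symm⟩
    · exact union_subset (fun x hx => (hrZ hx).1.1)
        (subset_union_right.trans (self_subset_thickening hr₀ _))

theorem theorem4p1 {X : Type*} [MetricSpace X] (hcurve : IsCurve X)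
    (hlc : LocallyConnectedSpace X) : ZeroCR X := by
  obtain ⟨hcomp, hconn, hdim⟩ := hcurve
  exact zeroCR_of_dense fun δ hδ =>
    dense_isSeparatedAt_chainRecurrentSet
      (smallInductiveDimension_le_iff.1 (by rw [hdim]; rfl)) hδ
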